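/- Consider a single-server queue in which customers $0,1,2,\dots$ arrive at the successive points $T_0<T_1<T_2<\cdots$ of a Poisson process of rate $\lambda>0$ on $(0,\infty)$, every service takes the same constant time $a>0$, the system is empty at time $0$, the number of waiting places is unlimited, and the policy is non-preemptive last-in-first-out: whenever the server is free and customers are present, the server at once takes the customer who arrived last among those waiting. Assume that the load $\rho=\lambda a$ satisfies $\rho<1$. Let $W_n$ be the waiting time of customer $n$ in the queue, i.e. the time from the arrival $T_n$ until the beginning of that customer's service. Then almost surely every customer is eventually served, exactly once, so that all the $W_n$ are well defined and finite, and the waiting time has an equilibrium distribution $\pi$: for every Borel set $B\subseteq\mathbb{R}$, $\Pr(W_n\in B)\to\pi(B)$ as $n\to\infty$. This equilibrium distribution is $$\pi(dx)=(1-\rho)\,\delta_0(dx)+f(x)\,dx ,$$ that is, an atom of mass $1-\rho$ at $0$ and otherwise a density $f\ge 0$, where $f(x)=0$ for $x\le 0$ and, for every integer $k\ge 0$ and every $x$ with $ka<x<(k+1)a$, $$f(x)=\frac{1}{k!}\,\lambda^{k+1}\,x^{k-1}\,(x-ka)\,e^{-\lambda x}.$$ -/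

import Mathlib

open MeasureTheory ProbabilityTheory Filter Topology

/-- The gaps between consecutive points of an increasing sequence of times, counted from time `0`:
`T 0, T 1 - T 0, T 2 - T 1, …`. -/
def interarrival {Ω : Type*} (T : ℕ → Ω → ℝ) : ℕ → Ω → ℝ
  | 0 => T 0
  | n + 1 => fun ω => T (n + 1) ω - T n ω

/-- `T 0 < T 1 < ⋯` are the successive points of a Poisson process of rate `r` on `(0, ∞)`:
the interarrival times are independent and exponentially distributed with rate `r`. -/
structure IsPoissonArrivals {Ω : Type*} [MeasurableSpace Ω] (P : Measure Ω) (r : ℝ)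
    (T : ℕ → Ω → ℝ) : Prop where
  hasLaw_interarrival : ∀ n, HasLaw (interarrival T n) (expMeasure r) P
  iIndepFun_interarrival : iIndepFun (interarrival T) P

/-- A record of one service: the time `start` at which it begins, the `customer` being served, and
the finite set `served` of all customers whose service has begun by then (this one included). -/
structure ServiceRecord where
  start : ℝ
  customer : ℕ
  served : Finset ℕ

/-- The successive services in a single-server queue with constant service time `a` under the
(non-preemptive) last-in-first-out policy, when customer `n` arrives at time `t n`
(`t` increasing to infinity, `t 0 > 0`) and the system is empty at time `0`.

The first service is that of customer `0`, upon arrival. After that, the next service begins as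
soon as the previous one is completed and an unserved customer is present, that is, at the later
of the completion time and the arrival time of the earliest unserved customer; the customer served
is the one who arrived last among all unserved customers present at that time. -/
noncomputable def lifoService (a : ℝ) (t : ℕ → ℝ) : ℕ → ServiceRecord
  | 0 => ⟨t 0, 0, {0}⟩
  | j + 1 =>
    let prev := lifoService a t j
    let b : ℝ := max (prev.start + a) (t (sInf {m : ℕ | m ∉ prev.served}))
    let c : ℕ := sSup {m : ℕ | m ∉ prev.served ∧ t m ≤ b}
    ⟨b, c, insert c prev.served⟩

/-- The waiting time of customer `n` in the queue, prior to service, under last-in-first-out: the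
time at which the service of customer `n` begins, minus the arrival time of customer `n`.
(The set below has one element, unless customer `n` is never served.) -/
noncomputable def lifoWait (a : ℝ) (t : ℕ → ℝ) (n : ℕ) : ℝ :=
  sInf {b : ℝ | ∃ j, (lifoService a t j).customer = n ∧ (lifoService a t j).start = b} - t n

/-- `π` is the equilibrium (steady-state) law of the sequence `W` of real random variables: the law
of `W n` converges to `π` as `n → ∞`, in the sense that the probability of every Borel set
converges. (With `B = univ` this makes `π` a probability measure, when `P` is one.) -/
structure IsEquilibriumLaw {Ω : Type*} [MeasurableSpace Ω] (P : Measure Ω) (W : ℕ → Ω → ℝ)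
    (π : Measure ℝ) : Prop where
  aemeasurable : ∀ n, AEMeasurable (W n) P
  tendsto : ∀ B : Set ℝ, MeasurableSet B → Tendsto (fun n => P.map (W n) B) atTop (𝓝 (π B))

/-! ### Pathwise analysis of the last-in-first-out queue. -/

section Lifo

variable {a : ℝ} {t : ℕ → ℝ}

/-! Under last-in-first-out, a customer who finds residual service time `u` waits exactly `u + k *
a`, where `k` counts the later arrivals served before it; older waiting customers are irrelevant
(`lifoWait_eq`). The times at which services start do not depend on the order of service, so the
workload found on arrival obeys Lindley's recursion, and `u` is that workload modulo `a`. The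
waiting time is thus a function of two independent ingredients: the workload found and the later
interarrival times (`map_workload_future`).

Run backwards, the workload after `n` steps is the maximum over `m ≤ n` of `m * a - S m`, with `S m`
the sum of the first `m` gaps. As `r * a < 1`, the law of large numbers makes it eventually constant
in `n` (`IsStable.exists_backwardWorkload_eq`). Hence its law converges on every Borel set, to a law
`ν` invariant under Lindley's recursion.

The law `ν` is never computed: only its image modulo `a` matters. Balancing upward and downward
crossings of levels gives `ν G = r * ∫ |G ∩ (v, v + a]| dν(v)` for `G ⊆ (0, ∞)`. When `G` is the
positive part of an `a`-periodic set, the integrand does not depend on `v`; so `u` has an atom `1 -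
r * a` at `0` and constant density `r` on `(0, a)` (`map_residualService_of_lindleyStep_eq`).

Given `u > 0`, the number `k` has the Borel–Tanner law, by induction on the first gap
(`measure_clearsAt`); given `u = 0` there is almost surely no wait. Since `x = u + k * a` determines
`u ∈ (0, a)` and `k`, the density at `x` is `r` times the Borel–Tanner weight. -/

lemma lifoService_served (a : ℝ) (t : ℕ → ℝ) (j : ℕ) :
    (lifoService a t j).served =
      (Finset.range (j + 1)).image fun i => (lifoService a t i).customer := by
  induction j with
  | zero => simp [lifoService]
  | succ j ih =>
    rw [Finset.range_add_one, Finset.image_insert, ← ih]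
    rfl

lemma notMem_lifoService_served {j m : ℕ} :
    m ∉ (lifoService a t j).served ↔ ∀ i < j + 1, (lifoService a t i).customer ≠ m := by
  simp [lifoService_served]

lemma finite_setOf_arrival_le (htop : Tendsto t atTop atTop) (b : ℝ) :
    {m : ℕ | t m ≤ b}.Finite := by
  have h := (htop.eventually_gt_atTop b)
  rw [← Nat.cofinite_eq_atTop, eventually_cofinite] at h
  simpa using h

lemma sInf_unserved_mem (a : ℝ) (t : ℕ → ℝ) (j : ℕ) :
    sInf {m : ℕ | m ∉ (lifoService a t j).served} ∉ (lifoService a t j).served :=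
  Nat.sInf_mem (Infinite.exists_notMem_finset (lifoService a t j).served)

/-- Each service goes to the last arrival among the waiting customers. -/
lemma isGreatest_lifoService_customer (ht : StrictMono t) (htop : Tendsto t atTop atTop) (j : ℕ) :
    IsGreatest {m : ℕ | (∀ i < j, (lifoService a t i).customer ≠ m) ∧
      t m ≤ (lifoService a t j).start} (lifoService a t j).customer := by
  cases j with
  | zero =>
    refine ⟨⟨by simp, le_rfl⟩, fun m hm => ?_⟩
    exact ht.le_iff_le.1 hm.2
  | succ j =>
    have hset : {m : ℕ | (∀ i < j + 1, (lifoService a t i).customer ≠ m) ∧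
        t m ≤ (lifoService a t (j + 1)).start} =
        {m : ℕ | m ∉ (lifoService a t j).served ∧ t m ≤ (lifoService a t (j + 1)).start} := by
      ext m
      simp only [Set.mem_ofPred_eq, notMem_lifoService_served]
    rw [hset]
    have hb : BddAbove {m : ℕ | m ∉ (lifoService a t j).served ∧
        t m ≤ (lifoService a t (j + 1)).start} :=
      ((finite_setOf_arrival_le htop _).subset fun m hm => hm.2).bddAbove
    exact ⟨Nat.sSup_mem ⟨_, sInf_unserved_mem a t j, le_max_right _ _⟩ hb,
      fun m hm => le_csSup hb hm⟩

lemma lifoService_customer_injective (ht : StrictMono t) (htop : Tendsto t atTop atTop) :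
    Function.Injective fun j => (lifoService a t j).customer :=
  Function.Injective.of_lt_imp_ne fun i j hij =>
    (isGreatest_lifoService_customer (a := a) ht htop j).1.1 i hij

lemma lifoService_start_strictMono (ha : 0 < a) :
    StrictMono fun j => (lifoService a t j).start :=
  strictMono_nat_of_lt_succ fun j =>
    (lt_add_of_pos_right _ ha).trans_le
      (le_max_left _ (t (sInf {m | m ∉ (lifoService a t j).served})))

/-- If a customer of index at most `n` is present, the next service starts immediately. -/
lemma lifoService_start_succ_of_unserved (ht : StrictMono t) {j n : ℕ}
    (hn : ∀ i < j + 1, (lifoService a t i).customer ≠ n)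
    (hle : t n ≤ (lifoService a t j).start + a) :
    (lifoService a t (j + 1)).start = (lifoService a t j).start + a := by
  refine max_eq_left (le_trans (ht.monotone ?_) hle)
  exact Nat.sInf_le (notMem_lifoService_served.2 hn)

/-- The times at which services start do not depend on the order of service. -/
lemma lifoService_start_succ (ha : 0 < a) (ht : StrictMono t) (htop : Tendsto t atTop atTop)
    (j : ℕ) :
    (lifoService a t (j + 1)).start = max ((lifoService a t j).start + a) (t (j + 1)) := by
  set A := (lifoService a t j).served with hA
  have hcard : A.card = j + 1 := by
    rw [hA, lifoService_served,
      Finset.card_image_of_injective _ (lifoService_customer_injective ht htop), Finset.card_range]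
  have hstart : (lifoService a t (j + 1)).start =
    max ((lifoService a t j).start + a) (t (sInf {m : ℕ | m ∉ A})) := rfl
  -- Either exactly the customers `0, …, j` have been served, and `j + 1` is the earliest unserved
  -- one; or somebody of index at least `j + 1` has been served, so `j + 1` has already arrived, and
  -- by counting an older customer is still waiting. In the second case both maxima are the
  -- completion time.
  by_cases hsub : A ⊆ Finset.range (j + 1)
  · have hA' : A = Finset.range (j + 1) :=
      Finset.eq_of_subset_of_card_le hsub (by simp [hcard])
    have : sInf {m : ℕ | m ∉ A} = j + 1 := by
      rw [hA']
      refine IsLeast.csInf_eq ⟨by simp, fun m hm => by simpa using hm⟩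
    rw [hstart, this]
  · obtain ⟨m, hmA, hm⟩ := Finset.not_subset.1 hsub
    have hm' : j + 1 ≤ m := by simpa using hm
    have htm : t (j + 1) ≤ (lifoService a t j).start := by
      rw [hA, lifoService_served, Finset.mem_image] at hmA
      obtain ⟨i, hi, rfl⟩ := hmA
      refine (ht.monotone hm').trans
        ((isGreatest_lifoService_customer (a := a) ht htop i).1.2.trans ?_)
      exact (lifoService_start_strictMono ha).monotone (by simpa [Nat.lt_succ_iff] using hi)
    have hex : ∃ i ∈ Finset.range (j + 1), i ∉ A := by
      by_contra! h
      have := Finset.eq_of_subset_of_card_le h (by simp [hcard])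
      exact hsub this.symm.subset
    obtain ⟨i, hi, hiA⟩ := hex
    have h1 : sInf {m : ℕ | m ∉ A} ≤ j + 1 :=
      (Nat.sInf_le (s := {m : ℕ | m ∉ A}) hiA).trans (Finset.mem_range.1 hi).le
    have h2 := ht.monotone h1
    rw [hstart, max_eq_left (by linarith), max_eq_left (by linarith)]

/-- The remaining service time, modulo `a`, found by customer `n`. -/
lemma exists_lifoService_start_eq (ha : 0 < a) (ht : StrictMono t)
    (htop : Tendsto t atTop atTop) (n : ℕ) :
    ∃ j, (∀ i < j, (lifoService a t i).start < t n) ∧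
      (lifoService a t j).start =
        t n + Int.fract (((lifoService a t n).start - t n) / a) * a := by
  set s := fun j => (lifoService a t j).start with hs
  have hsucc : ∀ j, s (j + 1) = max (s j + a) (t (j + 1)) := lifoService_start_succ ha ht htop
  have hex : ∃ j, t n ≤ s j := by
    refine ⟨n, ?_⟩
    cases n with
    | zero => exact le_rfl
    | succ n => rw [hsucc]; exact le_max_right _ _
  classical
  obtain ⟨j, hj, hmin⟩ : ∃ j, t n ≤ s j ∧ ∀ i < j, s i < t n :=
    ⟨Nat.find hex, Nat.find_spec hex, fun i hi => not_le.1 (Nat.find_min hex hi)⟩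
  have hjn : j ≤ n := by
    by_contra! h
    have h1 := hmin n h
    have h2 : t n ≤ s n := by
      cases n with
      | zero => exact le_rfl
      | succ n => rw [hsucc]; exact le_max_right _ _
    linarith
  -- The previous service began before `t n`, so it ends before `t n + a`; and `t j ≤ t n` as `j ≤
  -- n`.
  have hlt : s j < t n + a := by
    cases j with
    | zero =>
      have : s 0 = t 0 := rfl
      have := ht.monotone (Nat.zero_le n)
      linarith
    | succ j =>
      have h1 := hmin j (Nat.lt_succ_self j)
      have h2 := ht.monotone hjn
      rw [hsucc]
      exact max_lt (by linarith) (by linarith)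
  -- Customers up to `n` have all arrived by `s j`, so the server does not idle between services `j`
  -- and `n`. Hence `s n` and `s j` agree modulo `a`.
  have hadd : ∀ i, j + i ≤ n → s (j + i) = s j + i * a := by
    intro i
    induction i with
    | zero => simp
    | succ i ih =>
      intro hi
      have h1 := ih (by omega)
      have h2 : t (j + (i + 1)) ≤ t n := ht.monotone hi
      have h3 : (0 : ℝ) ≤ i * a := by positivity
      rw [← add_assoc] at h2 ⊢
      rw [hsucc, h1, max_eq_left (by linarith)]
      push_cast
      ring
  refine ⟨j, hmin, ?_⟩
  have hn := hadd (n - j) (by omega)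
  rw [Nat.add_sub_cancel' hjn] at hn
  have hdiv : (s n - t n) / a = (s j - t n) / a + (n - j : ℕ) := by
    rw [hn]
    field_simp
    ring
  change s j = t n + Int.fract ((s n - t n) / a) * a
  rw [hdiv, Int.fract_add_natCast, Int.fract_eq_self.2
    ⟨div_nonneg (by linarith) ha.le, (div_lt_one ha).2 (by linarith)⟩]
  field_simp
  ring

/-- Once a service starts after the arrival of customer `n`, the customers arriving later are
served first, until a service starts at a moment when all of them have been served. -/
lemma lifoService_customer_eq (ha : 0 < a) (ht : StrictMono t) (htop : Tendsto t atTop atTop)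
    {n j k : ℕ} (hbefore : ∀ i < j, (lifoService a t i).start < t n)
    (hj : t n ≤ (lifoService a t j).start)
    (hlt : ∀ i < k, t (n + 1 + i) ≤ (lifoService a t j).start + i * a)
    (hk : (lifoService a t j).start + k * a < t (n + 1 + k)) :
    (lifoService a t (j + k)).customer = n ∧
      (lifoService a t (j + k)).start = (lifoService a t j).start + k * a := by
  set s := fun j => (lifoService a t j).start with hs
  set c := fun j => (lifoService a t j).customer with hc
  have hgr : ∀ j, IsGreatest {m : ℕ | (∀ i < j, c i ≠ m) ∧ t m ≤ s j} (c j) :=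
    isGreatest_lifoService_customer ht htop
  have hinj : Function.Injective c := lifoService_customer_injective ht htop
  have hold : ∀ i < j, c i < n := fun i hi =>
    ht.lt_iff_lt.1 ((hgr i).1.2.trans_lt (hbefore i hi))
  -- Until service `j + k`, the server never idles and serves only customers newer than `n`.
  have key : ∀ i ≤ k, s (j + i) = s j + i * a ∧ ∀ l < i, n < c (j + l) := by
    intro i
    induction i with
    | zero => simp
    | succ i ih =>
      intro hi
      obtain ⟨hsi, hci⟩ := ih (by omega)
      have hne : ∀ l < j + i, c l ≠ n := by
        intro l hl
        rcases lt_or_ge l j with h | h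
        · exact (hold l h).ne
        · obtain ⟨l, rfl⟩ := Nat.exists_eq_add_of_le h
          exact (hci l (by omega)).ne'
      have hpos : (0 : ℝ) ≤ i * a := by positivity
      -- Pigeonhole: `i + 1` customers newer than `n` are present by now, and only `i` of them can
      -- have been served.
      have hex : ∃ m ∈ Finset.Ioc n (n + 1 + i),
          m ∉ (Finset.range i).image fun l => c (j + l) := by
        by_contra! h
        have := (Finset.card_le_card (show Finset.Ioc n (n + 1 + i) ⊆ _ from h)).trans
          Finset.card_image_le
        simp at this
        omega
      obtain ⟨m, hm, hmc⟩ := hex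
      rw [Finset.mem_Ioc] at hm
      have hnc : n < c (j + i) := by
        refine hm.1.trans_le ((hgr (j + i)).2 ⟨fun l hl => ?_, ?_⟩)
        · rcases lt_or_ge l j with h | h
          · exact ((hold l h).trans hm.1).ne
          · obtain ⟨l, rfl⟩ := Nat.exists_eq_add_of_le h
            intro hcm
            exact hmc (Finset.mem_image.2 ⟨l, Finset.mem_range.2 (by omega), hcm⟩)
        · rw [hsi]
          exact (ht.monotone hm.2).trans (hlt i (by omega))
      refine ⟨?_, fun l hl => ?_⟩
      · have h1 : s (j + i + 1) = s (j + i) + a := by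
          refine lifoService_start_succ_of_unserved (n := n) ht (fun l hl => ?_) ?_
          · rcases Nat.lt_succ_iff_lt_or_eq.1 hl with h | rfl
            · exact hne l h
            · exact hnc.ne'
          · change t n ≤ s (j + i) + a
            rw [hsi]
            linarith
        rw [← add_assoc, h1, hsi]
        push_cast
        ring
      · rcases Nat.lt_succ_iff_lt_or_eq.1 hl with h | rfl
        · exact hci l h
        · exact hnc
  obtain ⟨hsk, hck⟩ := key k le_rfl
  refine ⟨?_, hsk⟩
  have hpos : (0 : ℝ) ≤ k * a := by positivity
  have hge : n ≤ c (j + k) := by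
    refine (hgr (j + k)).2 ⟨fun l hl => ?_, by rw [hsk]; linarith⟩
    rcases lt_or_ge l j with h | h
    · exact (hold l h).ne
    · obtain ⟨l, rfl⟩ := Nat.exists_eq_add_of_le h
      exact (hck l (by omega)).ne'
  refine (hge.eq_or_lt.resolve_right fun hgt => ?_).symm
  -- Were service `j + k` also given to a newer customer, `k + 1` distinct customers would come from
  -- the `k` newer ones arrived by then.
  have hsub : (Finset.range (k + 1)).image (fun l => c (j + l)) ⊆ Finset.Ioc n (n + k) := by
    intro m hm
    obtain ⟨l, hl, rfl⟩ := Finset.mem_image.1 hm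
    have hl' : l ≤ k := by simpa [Nat.lt_succ_iff] using hl
    have h1 : t (c (j + l)) < t (n + 1 + k) := by
      refine lt_of_le_of_lt ((hgr (j + l)).1.2.trans ?_) hk
      rw [← hsk]
      exact (lifoService_start_strictMono ha).monotone (by omega)
    have h2 := ht.lt_iff_lt.1 h1
    refine Finset.mem_Ioc.2 ⟨?_, by omega⟩
    rcases hl'.eq_or_lt with rfl | h
    · exact hgt
    · exact hck l h
  have := Finset.card_le_card hsub
  rw [Finset.card_image_of_injective _
    (show Function.Injective fun l => c (j + l) from hinj.comp (add_right_injective j))] at this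
  simp at this

/-- The waiting time of customer `n`: the residual service time found on arrival, followed by the
services of customers arriving later. -/
lemma lifoWait_eq (ha : 0 < a) (ht : StrictMono t) (htop : Tendsto t atTop atTop) {n k : ℕ} {u : ℝ}
    (hu : u = Int.fract (((lifoService a t n).start - t n) / a) * a)
    (hlt : ∀ i < k, t (n + 1 + i) - t n ≤ u + i * a) (hk : u + k * a < t (n + 1 + k) - t n) :
    (∃ j, (lifoService a t j).customer = n) ∧ lifoWait a t n = u + k * a := by
  obtain ⟨j, hbefore, hj⟩ := exists_lifoService_start_eq ha ht htop n
  rw [← hu] at hj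
  have hu0 : 0 ≤ u := hu ▸ mul_nonneg (Int.fract_nonneg _) ha.le
  obtain ⟨hc, hs⟩ := lifoService_customer_eq ha ht htop (n := n) (j := j) (k := k) hbefore
    (by linarith) (fun i hi => by linarith [hlt i hi]) (by linarith)
  refine ⟨⟨_, hc⟩, ?_⟩
  have hset : {b : ℝ | ∃ j, (lifoService a t j).customer = n ∧ (lifoService a t j).start = b} =
      {(lifoService a t (j + k)).start} := by
    ext b
    constructor
    · rintro ⟨i, hi, rfl⟩
      have := lifoService_customer_injective (a := a) ht htop (hi.trans hc.symm)
      rw [this]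
      rfl
    · rintro rfl
      exact ⟨_, hc, rfl⟩
  rw [lifoWait, hset, csInf_singleton, hs, hj]
  ring

end Lifo

/-! ### Workload, clearing time and stability as functions of the interarrival sequence. -/

section SequenceSpace

/-- Customers remain to be served before the tagged one until time `u + k * a`, where `k` is the
value of this function: the first `k` for which at most `k` points `x 0, x 0 + x 1, …` lie in
`(0, u + k * a]`. -/
noncomputable def clearingIndex (a u : ℝ) (x : ℕ → ℝ) : ℕ :=
  sInf {k : ℕ | u + k * a < ∑ i ∈ Finset.range (k + 1), x i}

/-- The event that `clearingIndex a u x = k`. -/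
def ClearsAt (a u : ℝ) (x : ℕ → ℝ) (k : ℕ) : Prop :=
  u + k * a < ∑ i ∈ Finset.range (k + 1), x i ∧
    ∀ j < k, ∑ i ∈ Finset.range (j + 1), x i ≤ u + j * a

/-- The remaining service time of the customer in service, when the remaining workload is `v`
(and `0` if `v` is a multiple of `a`). -/
noncomputable def residualService (a v : ℝ) : ℝ := Int.fract (v / a) * a

/-- The workload found by customer `n`, when the interarrival times are `x`. -/
noncomputable def workload (a : ℝ) (x : ℕ → ℝ) : ℕ → ℝ
  | 0 => 0
  | n + 1 => max (workload a x n + a - x (n + 1)) 0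

/-- The workload after `n` steps of Lindley's recursion, run backwards in time. -/
noncomputable def backwardWorkload (a : ℝ) : ℕ → (ℕ → ℝ) → ℝ
  | 0, _ => 0
  | n + 1, x => max (backwardWorkload a n (fun i => x (i + 1)) + a - x 0) 0

/-- The equilibrium workload, as a function of the interarrival times in the past. -/
noncomputable def limitWorkload (a : ℝ) (x : ℕ → ℝ) : ℝ := ⨆ n, backwardWorkload a n x

/-- Positive interarrival times whose partial sums outgrow the services. -/
def IsStable (a : ℝ) (x : ℕ → ℝ) : Prop :=
  (∀ i, 0 < x i) ∧ Tendsto (fun n : ℕ => ∑ i ∈ Finset.range n, x i - n * a) atTop atTop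

variable {a : ℝ} {x : ℕ → ℝ}

lemma IsStable.shift (h : IsStable a x) : IsStable a fun i => x (i + 1) := by
  refine ⟨fun i => h.1 _, ?_⟩
  have h1 := tendsto_atTop_add_const_right atTop (a - x 0) ((tendsto_add_atTop_iff_nat 1).2 h.2)
  refine h1.congr fun n => ?_
  rw [Finset.sum_range_succ']
  push_cast
  ring

lemma IsStable.shift_add (h : IsStable a x) (n : ℕ) : IsStable a fun i => x (n + i) := by
  induction n with
  | zero => simpa using h
  | succ n ih => simpa [add_assoc, add_comm 1] using ih.shift

lemma IsStable.exists_clears (h : IsStable a x) (u : ℝ) :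
    ∃ k : ℕ, u + k * a < ∑ i ∈ Finset.range (k + 1), x i := by
  obtain ⟨k, hk⟩ := (((tendsto_add_atTop_iff_nat 1).2 h.2).eventually_gt_atTop (u - a)).exists
  refine ⟨k, ?_⟩
  push_cast at hk
  linarith

/-- The existence hypothesis excludes the default `sInf ∅ = 0`, which would not mean that the queue
clears at `0`. -/
lemma clearingIndex_eq_iff {u : ℝ}
    (h : ∃ k : ℕ, u + k * a < ∑ i ∈ Finset.range (k + 1), x i) {k : ℕ} :
    clearingIndex a u x = k ↔ ClearsAt a u x k := by
  constructor
  · rintro rfl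
    exact ⟨Nat.sInf_mem h, fun j hj => not_lt.1 (Nat.notMem_of_lt_sInf hj)⟩
  · intro hk
    refine IsLeast.csInf_eq ⟨hk.1, fun j hj => ?_⟩
    by_contra! hlt
    exact absurd (hk.2 j hlt) (not_le.2 hj)

lemma measurable_residualService (a : ℝ) : Measurable (residualService a) :=
  ((measurable_id.div_const a).fract).mul_const a

lemma measurableSet_clearsAt (a : ℝ) (k : ℕ) :
    MeasurableSet {p : ℝ × (ℕ → ℝ) | ClearsAt a p.1 p.2 k} := by
  have hlt : MeasurableSet {p : ℝ × (ℕ → ℝ) | p.1 + k * a < ∑ i ∈ Finset.range (k + 1), p.2 i} :=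
    measurableSet_lt (by fun_prop) (by fun_prop)
  refine hlt.inter ?_
  have : {p : ℝ × (ℕ → ℝ) | ∀ j < k, ∑ i ∈ Finset.range (j + 1), p.2 i ≤ p.1 + j * a} =
      ⋂ j, ⋂ _ : j < k, {p : ℝ × (ℕ → ℝ) | ∑ i ∈ Finset.range (j + 1), p.2 i ≤ p.1 + j * a} := by
    ext; simp
  change MeasurableSet {p : ℝ × (ℕ → ℝ) | ∀ j < k, _}
  rw [this]
  exact MeasurableSet.iInter fun j => MeasurableSet.iInter fun _ =>
    measurableSet_le (by fun_prop) (by fun_prop)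

lemma measurable_clearingIndex (a : ℝ) :
    Measurable fun p : ℝ × (ℕ → ℝ) => clearingIndex a p.1 p.2 := by
  refine measurable_to_countable' fun k => ?_
  have hN : MeasurableSet {p : ℝ × (ℕ → ℝ) |
      ∃ k : ℕ, p.1 + k * a < ∑ i ∈ Finset.range (k + 1), p.2 i} := by
    have : {p : ℝ × (ℕ → ℝ) | ∃ k : ℕ, p.1 + k * a < ∑ i ∈ Finset.range (k + 1), p.2 i} =
        ⋃ k : ℕ, {p : ℝ × (ℕ → ℝ) | p.1 + k * a < ∑ i ∈ Finset.range (k + 1), p.2 i} := by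
      ext; simp
    rw [this]
    exact MeasurableSet.iUnion fun k => measurableSet_lt (by fun_prop) (by fun_prop)
  -- The second piece accounts for the default value `0` on sequences that never clear.
  have : (fun p : ℝ × (ℕ → ℝ) => clearingIndex a p.1 p.2) ⁻¹' {k} =
      ({p | ∃ k : ℕ, p.1 + k * a < ∑ i ∈ Finset.range (k + 1), p.2 i} ∩
        {p : ℝ × (ℕ → ℝ) | ClearsAt a p.1 p.2 k}) ∪
      ({p | ∃ k : ℕ, p.1 + k * a < ∑ i ∈ Finset.range (k + 1), p.2 i}ᶜ ∩ {_p | 0 = k}) := by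
    ext p
    by_cases h : ∃ k : ℕ, p.1 + k * a < ∑ i ∈ Finset.range (k + 1), p.2 i
    · simp [h, clearingIndex_eq_iff h]
    · have h0 : clearingIndex a p.1 p.2 = 0 := by
        rw [clearingIndex, Nat.sInf_eq_zero]
        right
        ext k
        simpa using fun hk => h ⟨k, hk⟩
      simp [h, h0]
  rw [this]
  exact (hN.inter (measurableSet_clearsAt a k)).union (hN.compl.inter (MeasurableSet.const _))

lemma measurable_workload (a : ℝ) (n : ℕ) : Measurable fun x => workload a x n := by
  induction n with
  | zero => exact measurable_const
  | succ n ih => exact ((ih.add_const a).sub (measurable_pi_apply _)).max measurable_const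

lemma measurable_backwardWorkload (a : ℝ) (n : ℕ) : Measurable (backwardWorkload a n) := by
  induction n with
  | zero => exact measurable_const
  | succ n ih =>
    have : Measurable fun x : ℕ → ℝ => fun i => x (i + 1) := by fun_prop
    exact (((ih.comp this).add_const a).sub (measurable_pi_apply _)).max measurable_const

lemma measurable_limitWorkload (a : ℝ) : Measurable (limitWorkload a) :=
  Measurable.iSup (measurable_backwardWorkload a)

lemma backwardWorkload_nonneg (a : ℝ) (n : ℕ) (x : ℕ → ℝ) : 0 ≤ backwardWorkload a n x := by
  cases n with
  | zero => exact le_rfl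
  | succ n => exact le_max_right _ _

/-- Unrolling Lindley's recursion backwards gives a running maximum, hence monotonicity in `n`. The
induction needs all `x`, since the recursion shifts the sequence. -/
lemma backwardWorkload_succ (a : ℝ) (n : ℕ) (x : ℕ → ℝ) :
    backwardWorkload a (n + 1) x =
      max (backwardWorkload a n x) ((n + 1 : ℕ) * a - ∑ i ∈ Finset.range (n + 1), x i) := by
  induction n generalizing x with
  | zero => simp [backwardWorkload, max_comm]
  | succ n ih =>
    rw [backwardWorkload, ih, backwardWorkload, add_sub_assoc, ← max_add_add_right,
      max_right_comm, ← add_sub_assoc]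
    congr 1
    rw [Finset.sum_range_succ' _ (n + 1)]
    push_cast
    ring

/-- By stability the new terms of the running maximum are eventually at most `0`, so it stops
changing. This pathwise stabilization, stronger than convergence, later gives convergence of
probabilities on every Borel set. -/
lemma IsStable.exists_backwardWorkload_eq (h : IsStable a x) :
    ∃ N, ∀ n ≥ N, backwardWorkload a n x = limitWorkload a x := by
  obtain ⟨N, hN⟩ := eventually_atTop.1 (h.2.eventually_ge_atTop 0)
  have hmono : Monotone fun n => backwardWorkload a n x :=
    monotone_nat_of_le_succ fun n => by
      rw [backwardWorkload_succ]
      exact le_max_left _ _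
  have hconst : ∀ n ≥ N, backwardWorkload a n x = backwardWorkload a N x := by
    intro n hn
    induction n, hn using Nat.le_induction with
    | base => rfl
    | succ n hn ih =>
      have := hN (n + 1) (by omega)
      rw [backwardWorkload_succ, ← ih]
      exact max_eq_left (by linarith [backwardWorkload_nonneg a n x])
  have hle : ∀ n, backwardWorkload a n x ≤ backwardWorkload a N x := by
    intro n
    rcases le_total n N with hn | hn
    · exact hmono hn
    · exact (hconst n hn).le
  refine ⟨N, fun n hn => (hconst n hn).trans (le_antisymm ?_ (ciSup_le hle))⟩
  exact le_ciSup (f := fun n => backwardWorkload a n x) ⟨_, Set.forall_mem_range.2 hle⟩ N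

lemma IsStable.limitWorkload_eq (h : IsStable a x) :
    limitWorkload a x = max (limitWorkload a (fun i => x (i + 1)) + a - x 0) 0 := by
  obtain ⟨N, hN⟩ := h.exists_backwardWorkload_eq
  obtain ⟨N', hN'⟩ := h.shift.exists_backwardWorkload_eq
  rw [← hN (max N N' + 1) (by omega), ← hN' (max N N') (by omega), backwardWorkload]

lemma IsStable.limitWorkload_nonneg (h : IsStable a x) : 0 ≤ limitWorkload a x := by
  rw [h.limitWorkload_eq]
  exact le_max_right _ _

lemma IsStable.strictMono_sum (h : IsStable a x) :
    StrictMono fun n => ∑ i ∈ Finset.range (n + 1), x i :=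
  strictMono_nat_of_lt_succ fun n => by
    rw [Finset.sum_range_succ _ (n + 1)]
    exact lt_add_of_pos_right _ (h.1 _)

lemma IsStable.tendsto_sum (ha : 0 < a) (h : IsStable a x) :
    Tendsto (fun n => ∑ i ∈ Finset.range (n + 1), x i) atTop atTop := by
  refine tendsto_atTop_mono (fun n => ?_) ((tendsto_add_atTop_iff_nat 1).2 h.2)
  have : (0 : ℝ) ≤ (n + 1 : ℕ) * a := by positivity
  simpa using this

/-- Here `n` indexes services, not the customer served: the start times are those of
first-in-first-out, where a customer waits for the workload found. -/
lemma IsStable.lifoService_start (ha : 0 < a) (h : IsStable a x) (n : ℕ) :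
    (lifoService a (fun n => ∑ i ∈ Finset.range (n + 1), x i) n).start =
      ∑ i ∈ Finset.range (n + 1), x i + workload a x n := by
  induction n with
  | zero => simp [lifoService, workload]
  | succ n ih =>
    rw [lifoService_start_succ ha h.strictMono_sum (h.tendsto_sum ha), ih, workload,
      Finset.sum_range_succ _ (n + 1), ← max_add_add_left]
    congr 1 <;> ring

/-- The waiting time of customer `n` in terms of the workload found on arrival and of the later
interarrival times. -/
lemma IsStable.lifoWait_eq (ha : 0 < a) (h : IsStable a x) (n : ℕ) :
    (∃! j, (lifoService a (fun n => ∑ i ∈ Finset.range (n + 1), x i) j).customer = n) ∧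
    lifoWait a (fun n => ∑ i ∈ Finset.range (n + 1), x i) n =
      residualService a (workload a x n) +
        clearingIndex a (residualService a (workload a x n)) (fun i => x (n + 1 + i)) * a := by
  have hst := h.lifoService_start ha n
  obtain ⟨h1, h2⟩ := (clearingIndex_eq_iff ((h.shift_add (n + 1)).exists_clears
    (residualService a (workload a x n)))).1 rfl
  have hsum : ∀ k, ∑ i ∈ Finset.range (n + 1 + k + 1), x i - ∑ i ∈ Finset.range (n + 1), x i =
      ∑ i ∈ Finset.range (k + 1), x (n + 1 + i) := by
    intro k
    rw [add_assoc (n + 1), Finset.sum_range_add]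
    ring
  obtain ⟨⟨j, hj⟩, hw⟩ := _root_.lifoWait_eq ha h.strictMono_sum (h.tendsto_sum ha) (n := n)
    (k := clearingIndex a (residualService a (workload a x n)) fun i => x (n + 1 + i))
    (u := residualService a (workload a x n)) (by rw [hst, add_sub_cancel_left]; rfl)
    (fun i hi => by rw [hsum]; exact h2 i hi) (by rw [hsum]; exact h1)
  exact ⟨⟨j, hj, fun i hi => lifoService_customer_injective h.strictMono_sum (h.tendsto_sum ha)
    (hi.trans hj.symm)⟩, hw⟩

end SequenceSpace

/-! ### Independence, stability and convergence of the workload law. -/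

section Laws

/-- The law of the sequence of interarrival times. -/
noncomputable abbrev interarrivalLaw (r : ℝ) : Measure (ℕ → ℝ) :=
  Measure.infinitePi fun _ : ℕ => expMeasure r

/-- The law of the first coordinate and the shifted sequence, for an i.i.d. sequence. -/
lemma map_head_tail_infinitePi {α : Type*} [MeasurableSpace α] (ν : Measure α)
    [IsProbabilityMeasure ν] :
    (Measure.infinitePi fun _ : ℕ => ν).map (fun x => (x 0, fun i => x (i + 1))) =
      ν.prod (Measure.infinitePi fun _ : ℕ => ν) := by
  -- It is easier to show that the inverse map, prepending a coordinate, carries the product law to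
  -- the i.i.d. law: this can be tested on finite boxes.
  let cons : α × (ℕ → α) → ℕ → α := fun p i => Nat.casesOn i p.1 p.2
  have hcons : Measurable cons := by
    refine measurable_pi_iff.2 fun i => ?_
    cases i with
    | zero => exact measurable_fst
    | succ i => exact (measurable_pi_apply i).comp measurable_snd
  have h : (ν.prod (Measure.infinitePi fun _ : ℕ => ν)).map cons =
      Measure.infinitePi fun _ : ℕ => ν := by
    refine Measure.eq_infinitePi _ fun s t ht => ?_
    classical
    obtain ⟨N, hN⟩ : ∃ N, s ⊆ Finset.range (N + 1) :=
      ⟨s.sup id, fun i hi => Finset.mem_range.2 (Nat.lt_succ_of_le (Finset.le_sup (f := id) hi))⟩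
    set t' : ℕ → Set α := fun i => if i ∈ s then t i else Set.univ with ht'
    have hmt : ∀ i, MeasurableSet (t' i) := fun i => by
      simp only [ht']
      split_ifs
      exacts [ht i, MeasurableSet.univ]
    have hpre : cons ⁻¹' (Set.pi s t) =
        t' 0 ×ˢ (Set.pi (Finset.range N) fun i => t' (i + 1)) := by
      ext ⟨y, z⟩
      simp only [Set.mem_preimage, Set.mem_pi, Set.mem_prod, Finset.mem_coe, Finset.mem_range, ht']
      constructor
      · intro h
        refine ⟨?_, fun i _ => ?_⟩
        · split_ifs with h0
          exacts [h 0 h0, trivial]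
        · split_ifs with h0
          exacts [h (i + 1) h0, trivial]
      · rintro ⟨h0, h1⟩ i hi
        cases i with
        | zero => rwa [if_pos hi] at h0
        | succ i =>
          have := Finset.mem_range.1 (hN hi)
          simpa [hi] using h1 i (by omega)
    rw [Measure.map_apply hcons (MeasurableSet.pi s.countable_toSet fun i _ => ht i), hpre,
      Measure.prod_prod, Measure.infinitePi_pi _ fun i _ => hmt _, mul_comm,
      ← Finset.prod_range_succ' (fun i => ν (t' i)), ← Finset.prod_subset hN]
    · exact Finset.prod_congr rfl fun i hi => by simp [ht', hi]
    · intro i _ hi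
      simp [ht', hi]
  conv_lhs => rw [← h]
  rw [Measure.map_map (by fun_prop) hcons]
  exact Measure.map_id

/-- The effect on the law of the workload of one step of Lindley's recursion. -/
noncomputable def lindleyStep (r a : ℝ) (ν : Measure ℝ) : Measure ℝ :=
  (ν.prod (expMeasure r)).map fun p => max (p.1 + a - p.2) 0

variable {r a : ℝ}

lemma map_lindley_tail [IsProbabilityMeasure (expMeasure r)] {g : (ℕ → ℝ) → ℝ}
    (hg : Measurable g) :
    (interarrivalLaw r).map (fun x => max (g (fun i => x (i + 1)) + a - x 0) 0) =
      lindleyStep r a ((interarrivalLaw r).map g) := by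
  have h1 : (fun x : ℕ → ℝ => max (g (fun i => x (i + 1)) + a - x 0) 0) =
      (fun p : ℝ × ℝ => max (p.1 + a - p.2) 0) ∘ Prod.swap ∘ (Prod.map id g) ∘
        (fun x : ℕ → ℝ => (x 0, fun i => x (i + 1))) := rfl
  have : IsProbabilityMeasure ((interarrivalLaw r).map g) :=
    Measure.isProbabilityMeasure_map hg.aemeasurable
  rw [h1, ← Measure.map_map (by fun_prop) (by fun_prop),
    ← Measure.map_map (by fun_prop) (by fun_prop),
    ← Measure.map_map (by fun_prop) (by fun_prop), map_head_tail_infinitePi,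
    ← Measure.map_prod_map _ _ measurable_id hg, Measure.map_id, Measure.prod_swap]
  rfl

/-- The workload found by a customer is independent of the later interarrival times, and is
distributed as the backward workload. -/
lemma map_workload_future [IsProbabilityMeasure (expMeasure r)] (n : ℕ) :
    (interarrivalLaw r).map (fun x => (workload a x n, fun i => x (n + 1 + i))) =
      ((interarrivalLaw r).map (backwardWorkload a n)).prod (interarrivalLaw r) := by
  have : ∀ n, IsProbabilityMeasure ((interarrivalLaw r).map (backwardWorkload a n)) := fun n =>
    Measure.isProbabilityMeasure_map (measurable_backwardWorkload a n).aemeasurable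
  induction n with
  | zero =>
    have h1 : (fun x : ℕ → ℝ => (workload a x 0, fun i => x (0 + 1 + i))) =
        Prod.map (fun _ : ℝ => (0 : ℝ)) id ∘ fun x : ℕ → ℝ => (x 0, fun i => x (i + 1)) := by
      ext x i
      · rfl
      · simp [add_comm]
    have h2 : backwardWorkload a 0 = fun _ => 0 := rfl
    rw [h1, ← Measure.map_map (by fun_prop) (by fun_prop), map_head_tail_infinitePi,
      ← Measure.map_prod_map _ _ measurable_const measurable_id, Measure.map_id, h2,
      Measure.map_const, Measure.map_const]
    simp
  | succ n ih =>
    -- Split the first gap off the independent future and absorb it into the workload by one Lindley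
    -- step; the remaining future is again i.i.d. and independent.
    have h1 : (fun x : ℕ → ℝ => (workload a x (n + 1), fun i => x (n + 1 + 1 + i))) =
        (fun p : ℝ × (ℝ × (ℕ → ℝ)) => (max (p.1 + a - p.2.1) 0, p.2.2)) ∘
          Prod.map id (fun x : ℕ → ℝ => (x 0, fun i => x (i + 1))) ∘
          fun x : ℕ → ℝ => (workload a x n, fun i => x (n + 1 + i)) := by
      ext x i
      · rfl
      · simp only [Function.comp_apply, Prod.map_apply]
        congr 1
        ring
    have h2 : (fun p : ℝ × (ℝ × (ℕ → ℝ)) => (max (p.1 + a - p.2.1) 0, p.2.2)) =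
        Prod.map (fun p : ℝ × ℝ => max (p.1 + a - p.2) 0) id ∘ MeasurableEquiv.prodAssoc.symm :=
      rfl
    have hw := measurable_workload a n
    have h3 : backwardWorkload a (n + 1) =
      fun x => max (backwardWorkload a n (fun i => x (i + 1)) + a - x 0) 0 := rfl
    rw [h1, ← Measure.map_map (by fun_prop) (by fun_prop),
      ← Measure.map_map (by fun_prop) (by fun_prop), ih,
      ← Measure.map_prod_map _ _ measurable_id (by fun_prop), map_head_tail_infinitePi,
      Measure.map_id, h2, ← Measure.map_map (by fun_prop) (by fun_prop),
      ← Measure.prodAssoc_prod, MeasurableEquiv.map_symm_map,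
      ← Measure.map_prod_map _ _ (by fun_prop) measurable_id, Measure.map_id, h3,
      map_lindley_tail (measurable_backwardWorkload a n)]
    rfl

lemma measure_expMeasure_Iic (hr : 0 < r) (x : ℝ) :
    expMeasure r (Set.Iic x) = ENNReal.ofReal (if 0 ≤ x then 1 - Real.exp (-(r * x)) else 0) := by
  rw [← lintegral_exponentialPDF_eq_antiDeriv hr x, expMeasure, gammaMeasure,
    withDensity_apply _ measurableSet_Iic]
  rfl

lemma ae_expMeasure_pos (hr : 0 < r) : ∀ᵐ x ∂expMeasure r, 0 < x := by
  have := measure_expMeasure_Iic hr 0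
  rw [ae_iff]
  simp only [not_lt]
  change expMeasure r (Set.Iic 0) = 0
  simpa using this

lemma lintegral_expMeasure (g : ℝ → ENNReal) (hg : Measurable g) :
    ∫⁻ x, g x ∂expMeasure r = ∫⁻ x, exponentialPDF r x * g x := by
  rw [expMeasure, gammaMeasure, lintegral_withDensity_eq_lintegral_mul _ _ hg]
  · rfl
  · exact (measurable_gammaPDFReal 1 r).ennreal_ofReal

/-- On the half-line, `x` times the exponential density is `r⁻¹` times the density of the gamma law
of shape `2`, whose total mass is `1`. -/
lemma lintegral_ofReal_expMeasure (hr : 0 < r) :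
    ∫⁻ x, ENNReal.ofReal x ∂expMeasure r = ENNReal.ofReal r⁻¹ := by
  have h2 : ∫⁻ x, gammaPDF 2 r x = 1 := lintegral_gammaPDF_eq_one two_pos hr
  rw [lintegral_expMeasure _ (by fun_prop), ← mul_one (ENNReal.ofReal r⁻¹), ← h2,
    ← lintegral_const_mul (μ := volume) _
      (show Measurable (gammaPDF 2 r) from (measurable_gammaPDFReal 2 r).ennreal_ofReal)]
  refine lintegral_congr fun x => ?_
  rw [exponentialPDF_eq, gammaPDF_eq]
  split_ifs with hx
  · have hG : Real.Gamma 2 = 1 := by simp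
    rw [← ENNReal.ofReal_mul (by positivity), ← ENNReal.ofReal_mul (by positivity), hG,
      show (2 : ℝ) - 1 = 1 by norm_num, Real.rpow_one, Real.rpow_ofNat]
    congr 1
    field_simp
  · simp

lemma integrable_id_expMeasure (hr : 0 < r) : Integrable (fun x => x) (expMeasure r) := by
  refine ⟨aestronglyMeasurable_id, ?_⟩
  rw [hasFiniteIntegral_iff_ofReal ((ae_expMeasure_pos hr).mono fun x hx => hx.le),
    lintegral_ofReal_expMeasure hr]
  exact ENNReal.ofReal_lt_top

lemma integral_id_expMeasure (hr : 0 < r) : ∫ x, x ∂expMeasure r = r⁻¹ := by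
  rw [integral_eq_lintegral_of_nonneg_ae ((ae_expMeasure_pos hr).mono fun x hx => hx.le)
    aestronglyMeasurable_id, lintegral_ofReal_expMeasure hr,
    ENNReal.toReal_ofReal (inv_nonneg.2 hr.le)]

/-- By the strong law the average gap tends to `r⁻¹ > a`, so the partial sums outgrow `n * a`
linearly. -/
lemma ae_isStable (hr : 0 < r) (hρ : r * a < 1) : ∀ᵐ x ∂interarrivalLaw r, IsStable a x := by
  have := isProbabilityMeasure_expMeasure hr
  have hmp : ∀ i : ℕ, MeasurePreserving (Function.eval i) (interarrivalLaw r) (expMeasure r) :=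
    fun i => measurePreserving_eval_infinitePi _ i
  have hpos : ∀ᵐ x ∂interarrivalLaw r, ∀ i, 0 < x i :=
    ae_all_iff.2 fun i => (hmp i).quasiMeasurePreserving.ae (ae_expMeasure_pos hr)
  have hlaw := strong_law_ae_real (μ := interarrivalLaw r) (fun i x => x i)
    ((hmp 0).integrable_comp_of_integrable (integrable_id_expMeasure hr))
    (fun i j hij => (iIndepFun_infinitePi (P := fun _ : ℕ => expMeasure r)
      (X := fun _ y => y) fun _ => measurable_id).indepFun hij)
    (fun i => ⟨(hmp i).measurable.aemeasurable, (hmp 0).measurable.aemeasurable,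
      (hmp i).map_eq.trans (hmp 0).map_eq.symm⟩)
  have hmean : ∫ x, x 0 ∂interarrivalLaw r = r⁻¹ := by
    rw [← integral_id_expMeasure hr, ← (hmp 0).map_eq,
      integral_map (f := fun y : ℝ => y) (hmp 0).measurable.aemeasurable aestronglyMeasurable_id]
  filter_upwards [hpos, hlaw] with x hx hl
  rw [hmean] at hl
  refine ⟨hx, ?_⟩
  have hgap : 0 < r⁻¹ - a := by
    rw [sub_pos, ← one_div, lt_div_iff₀ hr]
    linarith
  have h1 := (hl.sub_const a).pos_mul_atTop hgap tendsto_natCast_atTop_atTop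
  refine h1.congr' ((eventually_gt_atTop 0).mono fun n hn => ?_)
  have : (n : ℝ) ≠ 0 := by positivity
  field_simp

/-- The law of the equilibrium workload is invariant under Lindley's recursion. -/
lemma lindleyStep_map_limitWorkload (hr : 0 < r) (hρ : r * a < 1) :
    lindleyStep r a ((interarrivalLaw r).map (limitWorkload a)) =
      (interarrivalLaw r).map (limitWorkload a) := by
  have := isProbabilityMeasure_expMeasure hr
  rw [← map_lindley_tail (measurable_limitWorkload a)]
  exact Measure.map_congr ((ae_isStable hr hρ).mono fun x hx => hx.limitWorkload_eq.symm)

/-- The law of the backward workloads converges setwise, jointly with an independent future. -/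
lemma tendsto_map_backwardWorkload_prod (hr : 0 < r) (hρ : r * a < 1) {A : Set (ℝ × (ℕ → ℝ))}
    (hA : MeasurableSet A) :
    Tendsto (fun n => (((interarrivalLaw r).map (backwardWorkload a n)).prod
      (interarrivalLaw r)) A) atTop
      (𝓝 ((((interarrivalLaw r).map (limitWorkload a)).prod (interarrivalLaw r)) A)) := by
  have := isProbabilityMeasure_expMeasure hr
  have hprod : ∀ {g : (ℕ → ℝ) → ℝ}, Measurable g →
      (((interarrivalLaw r).map g).prod (interarrivalLaw r)) A =
        ∫⁻ x, interarrivalLaw r (Prod.mk (g x) ⁻¹' A) ∂interarrivalLaw r := by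
    intro g hg
    rw [Measure.prod_apply hA, lintegral_map (measurable_measure_prodMk_left hA) hg]
  rw [hprod (measurable_limitWorkload a)]
  simp_rw [fun n => hprod (measurable_backwardWorkload a n)]
  refine tendsto_lintegral_of_dominated_convergence (fun _ => 1)
    (fun n => (measurable_measure_prodMk_left hA).comp (measurable_backwardWorkload a n))
    (fun n => ae_of_all _ fun x => prob_le_one) (by simp) ?_
  filter_upwards [ae_isStable hr hρ] with x hx
  obtain ⟨N, hN⟩ := hx.exists_backwardWorkload_eq
  exact tendsto_const_nhds.congr' ((eventually_ge_atTop N).mono fun n hn => by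
    simp only [hN n hn])

end Laws

/-! ### Level crossings and the law of the residual service time. -/

section RateConservation

variable {r a : ℝ}

lemma measurable_exponentialPDF (r : ℝ) : Measurable (exponentialPDF r) :=
  (measurable_exponentialPDFReal r).ennreal_ofReal

/-- The differential equation `r * F + F' = r` of the exponential distribution function, the only
feature of that law used in the crossing balance. -/
lemma ofReal_mul_expMeasure_Iic_add (hr : 0 < r) (w : ℝ) :
    ENNReal.ofReal r * expMeasure r (Set.Iic w) + exponentialPDF r w =
      (Set.Ici 0).indicator (fun _ => ENNReal.ofReal r) w := by
  rw [measure_expMeasure_Iic hr, exponentialPDF_eq]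
  by_cases hw : 0 ≤ w
  · have h1 : 0 ≤ 1 - Real.exp (-(r * w)) := by
      rw [sub_nonneg, Real.exp_le_one_iff]
      simpa using mul_nonneg hr.le hw
    rw [Set.indicator_of_mem (Set.mem_Ici.2 hw), if_pos hw, if_pos hw,
      ← ENNReal.ofReal_mul hr.le, ← ENNReal.ofReal_add (by positivity) (by positivity)]
    congr 1
    ring
  · simp [hw]

/-- With `H y = |G ∩ (-∞, y]|`, this describes the mean effect on `H` of draining from level `y` for
an exponential time. By Fubini both terms on the left are integrals over `s ∈ G`, of `r * F (y - s)`
and `F' (y - s)`. Truncation at `0` is invisible because `G` contains only positive levels. -/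
lemma lintegral_volume_inter_Iic_sub (hr : 0 < r) {G : Set ℝ} (hG : MeasurableSet G)
    (hG0 : G ⊆ Set.Ioi 0) (y : ℝ) :
    ENNReal.ofReal r * ∫⁻ x, volume (G ∩ Set.Iic (max (y - x) 0)) ∂expMeasure r +
      expMeasure r {x | max (y - x) 0 ∈ G} = ENNReal.ofReal r * volume (G ∩ Set.Iic y) := by
  have := isProbabilityMeasure_expMeasure hr
  have hA : ∫⁻ x, volume (G ∩ Set.Iic (max (y - x) 0)) ∂expMeasure r =
      ∫⁻ s in G, expMeasure r (Set.Iic (y - s)) := by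
    have h1 : ∀ x, volume (G ∩ Set.Iic (max (y - x) 0)) =
        ∫⁻ s in G, {p : ℝ × ℝ | p.1 ≤ y - p.2}.indicator 1 (x, s) := by
      intro x
      have hset : G ∩ Set.Iic (max (y - x) 0) = G ∩ {s | x ≤ y - s} := by
        ext s
        refine and_congr_right fun hs => ?_
        have : (0 : ℝ) < s := hG0 hs
        simp only [Set.mem_Iic, Set.mem_ofPred_eq, le_max_iff, not_le.2 this, or_false]
        exact le_sub_comm
      have hm : MeasurableSet {s | x ≤ y - s} := measurableSet_le (by fun_prop) (by fun_prop)
      rw [hset, Set.inter_comm, ← Measure.restrict_apply hm, ← lintegral_indicator_one hm]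
      rfl
    have hm : MeasurableSet {p : ℝ × ℝ | p.1 ≤ y - p.2} :=
      measurableSet_le (by fun_prop) (by fun_prop)
    simp_rw [h1]
    rw [lintegral_lintegral_swap (f := fun x s => {p : ℝ × ℝ | p.1 ≤ y - p.2}.indicator 1 (x, s))
      (measurable_one.indicator hm).aemeasurable]
    refine lintegral_congr fun s => ?_
    rw [← lintegral_indicator_one measurableSet_Iic]
    rfl
  have hB : expMeasure r {x | max (y - x) 0 ∈ G} = ∫⁻ s in G, exponentialPDF r (y - s) := by
    have hset : {x | max (y - x) 0 ∈ G} = (fun x => y - x) ⁻¹' G := by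
      ext x
      simp only [Set.mem_ofPred_eq, Set.mem_preimage]
      rcases le_total (y - x) 0 with h | h
      · rw [max_eq_right h]
        exact iff_of_false (fun h0 => lt_irrefl (0 : ℝ) (hG0 h0)) fun h0 => not_lt.2 h (hG0 h0)
      · rw [max_eq_left h]
    have hm : Measurable fun x => y - x := by fun_prop
    rw [hset, ← lintegral_indicator_one (hm hG), lintegral_expMeasure _
      (measurable_one.indicator (hm hG)),
      ← lintegral_sub_left_eq_self (fun x => exponentialPDF r x * _) y,
      ← lintegral_indicator hG]
    refine lintegral_congr fun s => ?_
    by_cases hs : s ∈ G <;> simp [hs]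
  have hm : Measurable fun s => exponentialPDF r (y - s) :=
    (measurable_exponentialPDF r).comp (by fun_prop)
  rw [hA, hB, ← lintegral_const_mul' _ _ ENNReal.ofReal_ne_top, ← lintegral_add_right _ hm]
  simp_rw [ofReal_mul_expMeasure_Iic_add hr]
  have : ∀ s, (Set.Ici 0).indicator (fun _ => ENNReal.ofReal r) (y - s) =
      (Set.Iic y).indicator (fun _ => ENNReal.ofReal r) s := by
    intro s
    by_cases hs : s ≤ y <;> simp [hs]
  simp_rw [this]
  rw [lintegral_indicator_const measurableSet_Iic, Measure.restrict_apply measurableSet_Iic,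
    Set.inter_comm]

lemma measurable_volume_inter_Ioc {G : Set ℝ} (hG : MeasurableSet G) (a : ℝ) :
    Measurable fun v : ℝ => volume (G ∩ Set.Ioc v (v + a)) := by
  have h1 : MeasurableSet {p : ℝ × ℝ | p.1 < p.2} := measurableSet_lt (by fun_prop) (by fun_prop)
  have h2 : MeasurableSet {p : ℝ × ℝ | p.2 ≤ p.1 + a} :=
    measurableSet_le (by fun_prop) (by fun_prop)
  have hm : MeasurableSet {p : ℝ × ℝ | p.2 ∈ G ∧ p.1 < p.2 ∧ p.2 ≤ p.1 + a} :=
    (measurable_snd hG).inter (h1.inter h2)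
  exact measurable_measure_prodMk_left hm

/-- In equilibrium the workload crosses each bounded set of levels upwards as often as
downwards. -/
lemma measure_eq_lintegral_of_lindleyStep_eq_of_bounded (hr : 0 < r) (ha : 0 ≤ a) {ν : Measure ℝ}
    [IsProbabilityMeasure ν] (hν : lindleyStep r a ν = ν) {G : Set ℝ} (hG : MeasurableSet G)
    {L : ℝ} (hGL : G ⊆ Set.Ioc 0 L) :
    ν G = ENNReal.ofReal r * ∫⁻ v, volume (G ∩ Set.Ioc v (v + a)) ∂ν := by
  have := isProbabilityMeasure_expMeasure hr
  have hstep : Measurable fun p : ℝ × ℝ => max (p.1 + a - p.2) 0 := by fun_prop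
  have hH : Measurable fun y => volume (G ∩ Set.Iic y) :=
    Monotone.measurable fun y z hyz =>
      measure_mono (Set.inter_subset_inter_right _ (Set.Iic_subset_Iic.2 hyz))
  -- Invariance of `ν`, tested on `|G ∩ (-∞, ·]|` here and on `G` itself in `h2`.
  have h1 : ∫⁻ v, ∫⁻ x, volume (G ∩ Set.Iic (max (v + a - x) 0)) ∂expMeasure r ∂ν =
      ∫⁻ v, volume (G ∩ Set.Iic v) ∂ν := by
    conv_rhs => rw [← hν, lindleyStep, lintegral_map hH hstep]
    exact (lintegral_prod (fun p => volume (G ∩ Set.Iic (max (p.1 + a - p.2) 0)))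
      (hH.comp hstep).aemeasurable).symm
  have h2 : ∫⁻ v, expMeasure r {x | max (v + a - x) 0 ∈ G} ∂ν = ν G := by
    conv_rhs => rw [← hν, lindleyStep, Measure.map_apply hstep hG,
      Measure.prod_apply (hstep hG)]
    rfl
  have h3 := lintegral_congr (μ := ν) fun v =>
    lintegral_volume_inter_Iic_sub hr hG (hGL.trans Set.Ioc_subset_Ioi_self) (v + a)
  have hm2 : Measurable fun v => expMeasure r {x | max (v + a - x) 0 ∈ G} :=
    measurable_measure_prodMk_left (hstep hG)
  rw [lintegral_add_right _ hm2, lintegral_const_mul' _ _ ENNReal.ofReal_ne_top,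
    lintegral_const_mul' _ _ ENNReal.ofReal_ne_top, h1, h2] at h3
  have h4 : ∀ v, volume (G ∩ Set.Iic (v + a)) =
      volume (G ∩ Set.Iic v) + volume (G ∩ Set.Ioc v (v + a)) := by
    intro v
    rw [← measure_union _ (hG.inter measurableSet_Ioc), ← Set.inter_union_distrib_left,
      Set.Iic_union_Ioc_eq_Iic (by linarith)]
    refine Set.disjoint_left.2 fun s hs hs' => ?_
    exact absurd hs.2 (not_le.2 hs'.2.1)
  simp_rw [h4] at h3
  rw [lintegral_add_left hH, mul_add] at h3
  -- The cancelled term must be finite; this is where boundedness of `G` enters.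
  refine (ENNReal.add_right_inj ?_).1 h3
  refine ENNReal.mul_ne_top ENNReal.ofReal_ne_top (ne_of_lt ?_)
  calc ∫⁻ v, volume (G ∩ Set.Iic v) ∂ν ≤ ∫⁻ _, volume (Set.Ioc 0 L) ∂ν :=
        lintegral_mono fun v => measure_mono (Set.inter_subset_left.trans hGL)
    _ < ⊤ := by simp

lemma measure_eq_lintegral_of_lindleyStep_eq (hr : 0 < r) (ha : 0 ≤ a) {ν : Measure ℝ}
    [IsProbabilityMeasure ν] (hν : lindleyStep r a ν = ν) {G : Set ℝ} (hG : MeasurableSet G)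
    (hG0 : G ⊆ Set.Ioi 0) :
    ν G = ENNReal.ofReal r * ∫⁻ v, volume (G ∩ Set.Ioc v (v + a)) ∂ν := by
  set g : ℕ → Set ℝ := fun n => G ∩ Set.Iic n with hg
  have hgm : ∀ n, MeasurableSet (g n) := fun n => hG.inter measurableSet_Iic
  have hmono : Monotone g := fun m n hmn =>
    Set.inter_subset_inter_right _ (Set.Iic_subset_Iic.2 (Nat.cast_le.2 hmn))
  have hU : ⋃ n, g n = G := by
    rw [hg, ← Set.inter_iUnion, Set.inter_eq_left]
    intro s _
    obtain ⟨n, hn⟩ := exists_nat_ge s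
    exact Set.mem_iUnion.2 ⟨n, hn⟩
  have h1 : ∀ n, ν (g n) = ENNReal.ofReal r * ∫⁻ v, volume (g n ∩ Set.Ioc v (v + a)) ∂ν :=
    fun n => measure_eq_lintegral_of_lindleyStep_eq_of_bounded hr ha hν (hgm n) (L := n)
      fun s hs => ⟨hG0 hs.1, hs.2⟩
  calc ν G = ⨆ n, ν (g n) := by rw [← hmono.measure_iUnion, hU]
    _ = ENNReal.ofReal r * ⨆ n, ∫⁻ v, volume (g n ∩ Set.Ioc v (v + a)) ∂ν := by
        rw [ENNReal.mul_iSup]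
        simp_rw [h1]
    _ = ENNReal.ofReal r * ∫⁻ v, volume (G ∩ Set.Ioc v (v + a)) ∂ν := by
        rw [← lintegral_iSup (fun n => measurable_volume_inter_Ioc (hgm n) a)
          fun m n hmn v => measure_mono (Set.inter_subset_inter_left _ (hmono hmn))]
        congr 1
        refine lintegral_congr fun v => ?_
        rw [← Monotone.measure_iUnion fun m n hmn => Set.inter_subset_inter_left _ (hmono hmn),
          ← Set.iUnion_inter, hU]

lemma residualService_eq_self (ha : 0 < a) {v : ℝ} (hv : v ∈ Set.Ico 0 a) :
    residualService a v = v := by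
  rw [residualService, Int.fract_eq_self.2 ⟨div_nonneg hv.1 ha.le, (div_lt_one ha).2 hv.2⟩]
  field_simp

/-- The preimage is `a`-periodic, so every window of length `a` contains the same amount of it. This
is the source of the uniform residual service time. -/
lemma volume_residualService_preimage_inter_Ioc (ha : 0 < a) {B : Set ℝ} (hB : MeasurableSet B)
    (v : ℝ) :
    volume (residualService a ⁻¹' B ∩ Set.Ioc v (v + a)) = volume (B ∩ Set.Ioo 0 a) := by
  have hper : Function.Periodic ((residualService a ⁻¹' B).indicator (1 : ℝ → ℝ)) a := by
    have : Function.Periodic (residualService a) a := fun x => by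
      rw [residualService, residualService, add_div, div_self ha.ne', Int.fract_add_one]
    intro x
    have hiff : x + a ∈ residualService a ⁻¹' B ↔ x ∈ residualService a ⁻¹' B := by
      rw [Set.mem_preimage, Set.mem_preimage, this x]
    by_cases hx : x ∈ residualService a ⁻¹' B
    · rw [Set.indicator_of_mem hx, Set.indicator_of_mem (hiff.2 hx), Pi.one_apply, Pi.one_apply]
    · rw [Set.indicator_of_notMem hx, Set.indicator_of_notMem fun h => hx (hiff.1 h)]
  have hm := measurable_residualService a hB
  have h1 : ∀ s, ∫ x in s..s + a, (residualService a ⁻¹' B).indicator (1 : ℝ → ℝ) x =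
      volume.real (residualService a ⁻¹' B ∩ Set.Ioc s (s + a)) := by
    intro s
    rw [intervalIntegral.integral_of_le (by linarith), integral_indicator_one hm,
      measureReal_restrict_apply hm]
  have h2 := hper.intervalIntegral_add_eq v 0
  rw [h1, h1, zero_add] at h2
  have hfin : ∀ s, volume (residualService a ⁻¹' B ∩ Set.Ioc s (s + a)) ≠ ⊤ := fun s =>
    ne_top_of_le_ne_top (by simp) (measure_mono Set.inter_subset_right)
  have hfin0 := hfin 0
  rw [zero_add] at hfin0
  rw [(measureReal_eq_measureReal_iff (hfin v) hfin0).1 h2]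
  have h3 : residualService a ⁻¹' B ∩ Set.Ioo 0 a = B ∩ Set.Ioo 0 a := by
    ext x
    refine and_congr_left fun hx => ?_
    rw [Set.mem_preimage, residualService_eq_self ha ⟨hx.1.le, hx.2⟩]
  rw [← h3]
  exact measure_congr ((ae_eq_refl _).inter Ioo_ae_eq_Ioc.symm)

/-- In equilibrium an arriving customer finds the server idle with probability `1 - r * a`, and
otherwise finds a uniformly distributed residual service time. -/
lemma map_residualService_of_lindleyStep_eq (hr : 0 < r) (ha : 0 < a)
    {ν : Measure ℝ} [IsProbabilityMeasure ν] (hν : lindleyStep r a ν = ν) (hν0 : ∀ᵐ v ∂ν, 0 ≤ v) :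
    ν.map (residualService a) = ENNReal.ofReal (1 - r * a) • Measure.dirac 0 +
      ENNReal.ofReal r • volume.restrict (Set.Ioo 0 a) := by
  have hres := measurable_residualService a
  -- Crossing balance for the positive levels with residue in `B`: the integrand is constant, so
  -- only the total mass of `ν` matters.
  have hpos : ∀ B : Set ℝ, MeasurableSet B → 0 ∉ B →
      ν.map (residualService a) B = ENNReal.ofReal r * volume (B ∩ Set.Ioo 0 a) := by
    intro B hB h0
    have h1 : ν (residualService a ⁻¹' B) = ν (residualService a ⁻¹' B ∩ Set.Ioi 0) := by
      refine measure_congr ?_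
      filter_upwards [hν0] with v hv
      refine propext ⟨fun h => ⟨h, hv.lt_of_ne ?_⟩, fun h => h.1⟩
      rintro rfl
      apply h0
      have : residualService a 0 ∈ B := h
      rwa [residualService_eq_self ha ⟨le_rfl, ha⟩] at this
    rw [Measure.map_apply hres hB, h1, measure_eq_lintegral_of_lindleyStep_eq hr ha.le hν
      ((hres hB).inter measurableSet_Ioi) Set.inter_subset_right]
    congr 1
    calc ∫⁻ v, volume (residualService a ⁻¹' B ∩ Set.Ioi 0 ∩ Set.Ioc v (v + a)) ∂ν
        = ∫⁻ _, volume (B ∩ Set.Ioo 0 a) ∂ν := by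
          refine lintegral_congr_ae ?_
          filter_upwards [hν0] with v hv
          rw [← volume_residualService_preimage_inter_Ioc ha hB v, Set.inter_assoc,
            Set.inter_eq_right.2 (show Set.Ioc v (v + a) ⊆ Set.Ioi 0 from
              fun s hs => lt_of_le_of_lt hv hs.1)]
      _ = volume (B ∩ Set.Ioo 0 a) := by simp
  have hzero : ν.map (residualService a) {0} = ENNReal.ofReal (1 - r * a) := by
    have : IsProbabilityMeasure (ν.map (residualService a)) :=
      Measure.isProbabilityMeasure_map hres.aemeasurable
    have h1 := hpos {0}ᶜ (measurableSet_singleton 0).compl (by simp)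
    rw [Set.inter_eq_right.2 fun s hs => hs.1.ne', Real.volume_Ioo, sub_zero,
      ← ENNReal.ofReal_mul hr.le] at h1
    rw [← compl_compl ({0} : Set ℝ), prob_compl_eq_one_sub (measurableSet_singleton 0).compl, h1,
      ENNReal.ofReal_sub _ (by positivity), ENNReal.ofReal_one]
  ext B hB
  rw [← measure_sdiff_add_inter B (measurableSet_singleton 0),
    hpos _ (hB.diff (measurableSet_singleton 0)) (by simp), Measure.add_apply, Measure.smul_apply,
    Measure.smul_apply, Measure.restrict_apply hB, Measure.dirac_apply' _ hB]
  have h2 : (B \ {0}) ∩ Set.Ioo 0 a = B ∩ Set.Ioo 0 a := by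
    ext s
    simp only [Set.mem_inter_iff, Set.mem_sdiff, Set.mem_singleton_iff, Set.mem_Ioo]
    constructor
    · tauto
    · rintro ⟨h, h'⟩
      exact ⟨⟨h, h'.1.ne'⟩, h'⟩
  rw [h2, add_comm, smul_eq_mul, smul_eq_mul]
  congr 1
  by_cases h0 : (0 : ℝ) ∈ B
  · rw [Set.inter_eq_right.2 (Set.singleton_subset_iff.2 h0), hzero]
    simp [h0]
  · rw [Set.inter_singleton_eq_empty.2 h0]
    simp [h0]

end RateConservation

/-! ### The Borel–Tanner law of the number of services needed to clear the queue. -/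

section BorelTanner

variable {r a : ℝ}

/-- The probability that exactly `k` services of length `a` are needed to clear an initial
workload `u` together with all later arrivals (the Borel–Tanner distribution). -/
noncomputable def borelTanner (r a u : ℝ) (k : ℕ) : ℝ :=
  r ^ k * (u + k * a) ^ ((k : ℤ) - 1) * u * Real.exp (-(r * (u + k * a))) / (k.factorial : ℝ)

lemma borelTanner_nonneg (hr : 0 ≤ r) (ha : 0 ≤ a) {u : ℝ} (hu : 0 ≤ u) (k : ℕ) :
    0 ≤ borelTanner r a u k := by
  rw [borelTanner]
  positivity

/-- First-gap decomposition: an arrival after time `x 0 ≤ u` leaves `u - x 0` of the initial work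
and brings a service `a`; the clearing problem restarts with one service fewer to count. -/
lemma clearsAt_succ {u : ℝ} {x : ℕ → ℝ} {k : ℕ} :
    ClearsAt a u x (k + 1) ↔
      x 0 ≤ u ∧ ClearsAt a (u - x 0 + a) (fun i => x (i + 1)) k := by
  have hiff : ∀ j : ℕ, ∑ i ∈ Finset.range (j + 1 + 1), x i ≤ u + (j + 1 : ℕ) * a ↔
      ∑ i ∈ Finset.range (j + 1), x (i + 1) ≤ u - x 0 + a + j * a := by
    intro j
    rw [Finset.sum_range_succ']
    push_cast
    constructor <;> intro h <;> linarith
  rw [ClearsAt, ClearsAt, ← not_le, hiff, not_le]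
  constructor
  · rintro ⟨h1, h2⟩
    exact ⟨by simpa using h2 0 (Nat.succ_pos k), h1, fun j hj => (hiff j).1 (h2 _ (by omega))⟩
  · rintro ⟨h0, h1, h2⟩
    refine ⟨h1, fun j hj => ?_⟩
    cases j with
    | zero => simpa using h0
    | succ j => exact (hiff j).2 (h2 j (by omega))

lemma hasDerivAt_mul_pow_div (ha : 0 < a) (k : ℕ) {u y : ℝ} (hy : y ≤ u) :
    HasDerivAt (fun y => -((u - y) * (u - y + (k + 1) * a) ^ k / (k + 1)))
      ((u - y + a) * (u - y + (k + 1) * a) ^ ((k : ℤ) - 1)) y := by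
  have h1 : HasDerivAt (fun y => u - y) (-1) y := (hasDerivAt_id y).const_sub u
  have h2 := (((h1.mul ((h1.add_const ((k + 1) * a)).pow k)).div_const ((k : ℝ) + 1))).neg
  refine h2.congr_deriv ?_
  have hb : 0 < u - y + (k + 1) * a := by
    have : 0 < (k + 1 : ℝ) * a := by positivity
    linarith
  cases k with
  | zero =>
    norm_num at hb ⊢
    rw [mul_inv_cancel₀ hb.ne']
  | succ k =>
    push_cast at hb ⊢
    simp only [Pi.pow_apply, add_sub_cancel_right, zpow_natCast]
    field_simp
    ring

/-- The weights satisfy the first-gap recursion. The exponentials multiply to a factor free of `y`,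
collected in `C`, and the algebraic factor `D` has the antiderivative of `hasDerivAt_mul_pow_div`.
-/
lemma lintegral_borelTanner (hr : 0 < r) (ha : 0 < a) {u : ℝ} (hu : 0 < u) (k : ℕ) :
    ∫⁻ y, (Set.Iic u).indicator (fun y => ENNReal.ofReal (borelTanner r a (u - y + a) k)) y
      ∂expMeasure r = ENNReal.ofReal (borelTanner r a u (k + 1)) := by
  set C : ℝ := r ^ (k + 1) * Real.exp (-(r * (u + (k + 1) * a))) / k.factorial with hC
  have hC0 : 0 ≤ C := by positivity
  set D : ℝ → ℝ := fun y => (u - y + a) * (u - y + (k + 1) * a) ^ ((k : ℤ) - 1) with hD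
  have hb : ∀ y ≤ u, 0 < u - y + (k + 1) * a := fun y hy => by
    have : 0 < (k + 1 : ℝ) * a := by positivity
    linarith
  have hD0 : ∀ y ≤ u, 0 ≤ D y := fun y hy =>
    mul_nonneg (by linarith) (zpow_nonneg (hb y hy).le _)
  have hDc : ContinuousOn D (Set.uIcc 0 u) := by
    rw [Set.uIcc_of_le hu.le]
    refine ContinuousOn.mul (by fun_prop) (ContinuousOn.zpow₀ (by fun_prop) _ ?_)
    exact fun y hy => Or.inl (hb y hy.2).ne'
  have hmeas : Measurable ((Set.Iic u).indicator
      fun y => ENNReal.ofReal (borelTanner r a (u - y + a) k)) := by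
    refine Measurable.indicator ?_ measurableSet_Iic
    refine Measurable.ennreal_ofReal ?_
    simp only [borelTanner]
    refine Measurable.div_const (Measurable.mul (Measurable.mul (Measurable.mul measurable_const
      ?_) (by fun_prop)) (by fun_prop)) _
    exact (show Measurable fun y => u - y + a + k * a by fun_prop).pow_const ((k : ℤ) - 1)
  have hint : ∫⁻ y in Set.Ioc 0 u, ENNReal.ofReal (C * D y) = ENNReal.ofReal
      (C * (u * (u + (k + 1) * a) ^ k / (k + 1))) := by
    have hii := hDc.intervalIntegrable (μ := volume)
    rw [← ofReal_integral_eq_lintegral_ofReal, ← intervalIntegral.integral_of_le hu.le,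
      intervalIntegral.integral_const_mul,
      intervalIntegral.integral_eq_sub_of_hasDerivAt (fun y hy => hasDerivAt_mul_pow_div ha k
        (by rw [Set.uIcc_of_le hu.le] at hy; exact hy.2)) hii]
    · simp
    · exact ((intervalIntegrable_iff_integrableOn_Ioc_of_le hu.le).1 hii).const_mul C
    · filter_upwards [ae_restrict_mem measurableSet_Ioc] with y hy
      exact mul_nonneg hC0 (hD0 y hy.2)
  rw [lintegral_expMeasure _ hmeas]
  calc ∫⁻ y, exponentialPDF r y * (Set.Iic u).indicator
        (fun y => ENNReal.ofReal (borelTanner r a (u - y + a) k)) y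
      = ∫⁻ y, (Set.Icc 0 u).indicator (fun y => ENNReal.ofReal (C * D y)) y := by
        refine lintegral_congr fun y => ?_
        by_cases hy : y ∈ Set.Icc 0 u
        · rw [Set.indicator_of_mem hy, Set.indicator_of_mem (Set.mem_Iic.2 hy.2),
            exponentialPDF_of_nonneg hy.1, ← ENNReal.ofReal_mul (by positivity)]
          congr 1
          have he : Real.exp (-(r * (u + (k + 1) * a))) =
              Real.exp (-(r * y)) * Real.exp (-(r * (u - y + a + k * a))) := by
            rw [← Real.exp_add]
            congr 1
            ring
          have hbase : u - y + a + k * a = u - y + (k + 1) * a := by ring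
          simp only [hC, hD, borelTanner, he]
          rw [hbase]
          ring
        · rw [Set.indicator_of_notMem hy]
          rcases lt_or_ge y 0 with h | h
          · rw [exponentialPDF_of_neg h, zero_mul]
          · rw [Set.indicator_of_notMem fun h' : y ∈ Set.Iic u => hy ⟨h, h'⟩, mul_zero]
    _ = ENNReal.ofReal (C * (u * (u + (k + 1) * a) ^ k / (k + 1))) := by
        rw [lintegral_indicator measurableSet_Icc, ← hint, setLIntegral_congr Ioc_ae_eq_Icc]
    _ = ENNReal.ofReal (borelTanner r a u (k + 1)) := by
        congr 1
        rw [borelTanner, hC, Nat.factorial_succ]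
        push_cast
        rw [add_sub_cancel_right, zpow_natCast]
        field_simp

lemma measurableSet_setOf_clearsAt (a u : ℝ) (k : ℕ) :
    MeasurableSet {x : ℕ → ℝ | ClearsAt a u x k} :=
  measurable_prodMk_left (measurableSet_clearsAt a k)

/-- Induction on `k` over all `u > 0`, integrating out the first gap; the base case says that no
customer arrives during the initial work. -/
lemma measure_clearsAt (hr : 0 < r) (ha : 0 < a) (k : ℕ) {u : ℝ} (hu : 0 < u) :
    interarrivalLaw r {x | ClearsAt a u x k} = ENNReal.ofReal (borelTanner r a u k) := by
  have := isProbabilityMeasure_expMeasure hr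
  induction k generalizing u with
  | zero =>
    have hset : {x : ℕ → ℝ | ClearsAt a u x 0} = Function.eval 0 ⁻¹' (Set.Iic u)ᶜ := by
      ext x
      simp [ClearsAt]
    rw [hset, (measurePreserving_eval_infinitePi (fun _ : ℕ => expMeasure r) 0).measure_preimage
      measurableSet_Iic.compl.nullMeasurableSet, prob_compl_eq_one_sub measurableSet_Iic,
      measure_expMeasure_Iic hr, if_pos hu.le, ← ENNReal.ofReal_one, ← ENNReal.ofReal_sub]
    · congr 1
      simp [borelTanner, hu.ne']
    · rw [sub_nonneg, Real.exp_le_one_iff]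
      simpa using mul_nonneg hr.le hu.le
  | succ k ih =>
    have hS : MeasurableSet {p : ℝ × (ℕ → ℝ) | p.1 ≤ u ∧ ClearsAt a (u - p.1 + a) p.2 k} := by
      have h1 : MeasurableSet {p : ℝ × (ℕ → ℝ) | p.1 ≤ u} :=
        measurableSet_le (by fun_prop) (by fun_prop)
      have h2 : Measurable fun p : ℝ × (ℕ → ℝ) => (u - p.1 + a, p.2) := by fun_prop
      exact h1.inter (h2 (measurableSet_clearsAt a k))
    have hset : {x : ℕ → ℝ | ClearsAt a u x (k + 1)} = (fun x => (x 0, fun i => x (i + 1))) ⁻¹'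
        {p : ℝ × (ℕ → ℝ) | p.1 ≤ u ∧ ClearsAt a (u - p.1 + a) p.2 k} := by
      ext x
      exact clearsAt_succ
    rw [hset, ← Measure.map_apply (by fun_prop) hS, map_head_tail_infinitePi,
      Measure.prod_apply hS, ← lintegral_borelTanner hr ha hu k]
    refine lintegral_congr fun y => ?_
    by_cases hy : y ≤ u
    · rw [Set.indicator_of_mem (Set.mem_Iic.2 hy), ← ih (by linarith)]
      congr 1
      ext x
      simp [hy]
    · rw [Set.indicator_of_notMem (by simpa using hy)]
      simp [hy]

/-- The waiting time, given the residual service time `u` at arrival and the later interarrival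
times. -/
noncomputable def waitFrom (a : ℝ) (p : ℝ × (ℕ → ℝ)) : ℝ := p.1 + clearingIndex a p.1 p.2 * a

lemma measurable_waitFrom (a : ℝ) : Measurable (waitFrom a) :=
  measurable_fst.add (((measurable_from_top (f := fun n : ℕ => (n : ℝ))).comp
    (measurable_clearingIndex a)).mul_const a)

lemma measure_waitFrom_of_pos (hr : 0 < r) (ha : 0 < a) (hρ : r * a < 1) {u : ℝ} (hu : 0 < u)
    (B : Set ℝ) :
    interarrivalLaw r {x | waitFrom a (u, x) ∈ B} =
      ∑' k : ℕ, B.indicator (fun _ => ENNReal.ofReal (borelTanner r a u k)) (u + k * a) := by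
  have h1 : interarrivalLaw r {x | waitFrom a (u, x) ∈ B} =
      interarrivalLaw r (⋃ k : ℕ, {x | ClearsAt a u x k ∧ u + k * a ∈ B}) := by
    refine measure_congr ?_
    filter_upwards [ae_isStable hr hρ] with x hx
    have hiff := fun k => clearingIndex_eq_iff (hx.exists_clears u) (k := k)
    refine propext ⟨fun h => Set.mem_iUnion.2 ⟨_, (hiff _).1 rfl, h⟩, fun h => ?_⟩
    obtain ⟨k, hk, hB⟩ := Set.mem_iUnion.1 h
    change u + clearingIndex a u x * a ∈ B
    rwa [(hiff k).2 hk]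
  rw [h1, measure_iUnion]
  · refine tsum_congr fun k => ?_
    by_cases hk : u + k * a ∈ B
    · simp [hk, measure_clearsAt hr ha k hu]
    · simp [hk]
  · intro i j hij
    refine Set.disjoint_left.2 fun x hi hj => hij ?_
    rw [← (clearingIndex_eq_iff ⟨i, hi.1.1⟩).2 hi.1, (clearingIndex_eq_iff ⟨i, hi.1.1⟩).2 hj.1]
  · intro k
    exact (measurableSet_setOf_clearsAt a u k).inter (MeasurableSet.const _)

lemma measure_waitFrom_zero (hr : 0 < r) (hρ : r * a < 1) {B : Set ℝ} (hB : MeasurableSet B) :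
    interarrivalLaw r {x | waitFrom a (0, x) ∈ B} = Measure.dirac 0 B := by
  have := isProbabilityMeasure_expMeasure hr
  have h : (fun x => waitFrom a (0, x)) =ᵐ[interarrivalLaw r] fun _ => 0 := by
    filter_upwards [ae_isStable hr hρ] with x hx
    have : clearingIndex a 0 x = 0 :=
      (clearingIndex_eq_iff (hx.exists_clears 0)).2 ⟨by simpa using hx.1 0, by simp⟩
    simp [waitFrom, this]
  have hm : Measurable fun x => waitFrom a (0, x) := (measurable_waitFrom a).comp (by fun_prop)
  have h2 : (interarrivalLaw r).map (fun x => waitFrom a (0, x)) = Measure.dirac 0 := by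
    rw [Measure.map_congr h, Measure.map_const, measure_univ, one_smul]
  rw [← h2, Measure.map_apply hm hB]
  rfl

end BorelTanner

/-! ### The equilibrium waiting time and the main theorem. -/

section Equilibrium

variable {r a : ℝ}

/-- The density of the equilibrium waiting time on `(0, ∞)`. -/
noncomputable def waitDensity (r a x : ℝ) : ℝ :=
  if x ≤ 0 then 0 else r * borelTanner r a (x - ⌊x / a⌋₊ * a) ⌊x / a⌋₊

lemma measurable_waitDensity (r a : ℝ) : Measurable (waitDensity r a) := by
  refine Measurable.ite measurableSet_Iic measurable_const (Measurable.const_mul ?_ r)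
  have h : Measurable fun p : ℕ × ℝ => borelTanner r a (p.2 - p.1 * a) p.1 := by
    refine measurable_from_prod_countable_right fun k => ?_
    simp only [borelTanner, sub_add_cancel]
    exact ((((measurable_id.pow_const ((k : ℤ) - 1)).const_mul _).mul (by fun_prop)).mul
      (by fun_prop)).div_const _
  exact h.comp ((Nat.measurable_floor.comp (measurable_id.div_const a)).prodMk measurable_id)

lemma waitDensity_nonneg (hr : 0 ≤ r) (ha : 0 < a) (x : ℝ) : 0 ≤ waitDensity r a x := by
  rw [waitDensity]
  split_ifs with hx
  · exact le_rfl
  · refine mul_nonneg hr (borelTanner_nonneg hr ha.le ?_ _)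
    have := Nat.floor_le (div_nonneg (not_le.1 hx).le ha.le)
    rw [le_div_iff₀ ha] at this
    linarith

lemma waitDensity_add_mul (ha : 0 < a) {u : ℝ} (hu : u ∈ Set.Ioo 0 a) (k : ℕ) :
    waitDensity r a (u + k * a) = r * borelTanner r a u k := by
  have hk : (0 : ℝ) ≤ k * a := by positivity
  have hfloor : ⌊(u + k * a) / a⌋₊ = k := by
    rw [Nat.floor_eq_iff (div_nonneg (by linarith [hu.1]) ha.le), le_div_iff₀ ha, div_lt_iff₀ ha]
    constructor
    · linarith [hu.1]
    · linarith [hu.2]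
  rw [waitDensity, if_neg (by linarith [hu.1]), hfloor, add_sub_cancel_right]

lemma waitDensity_eq (ha : 0 < a) (k : ℕ) {x : ℝ} (h1 : k * a < x) (h2 : x < (k + 1) * a) :
    waitDensity r a x = r ^ (k + 1) * x ^ ((k : ℤ) - 1) * (x - k * a) * Real.exp (-(r * x)) /
      (k.factorial : ℝ) := by
  have h := waitDensity_add_mul (r := r) ha (u := x - k * a) ⟨by linarith, by linarith⟩ k
  rw [sub_add_cancel] at h
  rw [h, borelTanner, sub_add_cancel]
  ring

/-- Splitting the half-line into translates of a fundamental interval. -/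
lemma setLIntegral_Ici_eq_tsum (ha : 0 < a) {g : ℝ → ENNReal} (hg : Measurable g) :
    ∫⁻ y in Set.Ici 0, g y = ∫⁻ u in Set.Ioo 0 a, ∑' k : ℕ, g (u + k * a) := by
  have hU : Set.Ici (0 : ℝ) = ⋃ k : ℕ, Set.Ico (k * a) (k * a + a) := by
    ext y
    simp only [Set.mem_Ici, Set.mem_iUnion, Set.mem_Ico]
    constructor
    · intro hy
      refine ⟨⌊y / a⌋₊, ?_, ?_⟩
      · exact (le_div_iff₀ ha).1 (Nat.floor_le (div_nonneg hy ha.le))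
      · have := (div_lt_iff₀ ha).1 (Nat.lt_floor_add_one (y / a))
        linarith
    · rintro ⟨k, hk, -⟩
      exact le_trans (by positivity) hk
  have hdisj : Pairwise (Function.onFun Disjoint fun k : ℕ => Set.Ico (k * a) (k * a + a)) := by
    refine (pairwise_disjoint_on _).2 fun m n hmn => Set.disjoint_left.2 fun y hy hy' => ?_
    have : (m + 1 : ℝ) ≤ n := by exact_mod_cast hmn
    nlinarith [hy.2, hy'.1]
  rw [hU, lintegral_iUnion (fun _ => measurableSet_Ico) hdisj, lintegral_tsum]
  · refine tsum_congr fun k => ?_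
    rw [← lintegral_indicator measurableSet_Ico, ← lintegral_add_right_eq_self _ (k * a),
      setLIntegral_congr Ioo_ae_eq_Ico, ← lintegral_indicator measurableSet_Ico]
    refine lintegral_congr fun u => ?_
    by_cases hu : u ∈ Set.Ico 0 a
    · rw [Set.indicator_of_mem hu, Set.indicator_of_mem]
      exact ⟨by linarith [hu.1], by linarith [hu.2]⟩
    · rw [Set.indicator_of_notMem hu, Set.indicator_of_notMem]
      exact fun h => hu ⟨by linarith [h.1], by linarith [h.2]⟩
  · exact fun k => (hg.comp (by fun_prop)).aemeasurable

/-- The law of the waiting time in equilibrium. -/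
lemma map_waitFrom_limitWorkload (hr : 0 < r) (ha : 0 < a) (hρ : r * a < 1) :
    (((interarrivalLaw r).map (limitWorkload a)).prod (interarrivalLaw r)).map
      (fun p => waitFrom a (residualService a p.1, p.2)) =
      ENNReal.ofReal (1 - r * a) • Measure.dirac 0 +
        volume.withDensity (fun x => ENNReal.ofReal (waitDensity r a x)) := by
  have := isProbabilityMeasure_expMeasure hr
  set ν := (interarrivalLaw r).map (limitWorkload a) with hν
  have : IsProbabilityMeasure ν :=
    Measure.isProbabilityMeasure_map (measurable_limitWorkload a).aemeasurable
  have hν0 : ∀ᵐ v ∂ν, 0 ≤ v :=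
    (ae_map_iff (measurable_limitWorkload a).aemeasurable measurableSet_Ici).2
      ((ae_isStable hr hρ).mono fun x hx => hx.limitWorkload_nonneg)
  have hres := measurable_residualService a
  have hwait := measurable_waitFrom a
  have hcomp : (fun p : ℝ × (ℕ → ℝ) => waitFrom a (residualService a p.1, p.2)) =
    waitFrom a ∘ Prod.map (residualService a) id := rfl
  rw [hcomp, ← Measure.map_map hwait (by fun_prop), ← Measure.map_prod_map _ _ hres measurable_id,
    Measure.map_id, map_residualService_of_lindleyStep_eq hr ha
      (lindleyStep_map_limitWorkload hr hρ) hν0]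
  have hf := measurable_waitDensity r a
  ext B hB
  have hm : Measurable fun u => interarrivalLaw r {x | waitFrom a (u, x) ∈ B} :=
    measurable_measure_prodMk_left (hwait hB)
  rw [Measure.map_apply hwait hB, Measure.prod_apply (hwait hB)]
  -- Condition on the residual service time: its atom at `0` gives the atom of the waiting time, its
  -- uniform part on `(0, a)` the density, through `x = u + k * a`.
  change ∫⁻ u, interarrivalLaw r {x | waitFrom a (u, x) ∈ B} ∂_ = _
  rw [lintegral_add_measure, lintegral_smul_measure, lintegral_smul_measure, lintegral_dirac' _ hm,
    measure_waitFrom_zero hr hρ hB, Measure.add_apply, Measure.smul_apply,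
    withDensity_apply _ hB, ← lintegral_indicator hB]
  congr 1
  have hI : ∫⁻ y, B.indicator (fun y => ENNReal.ofReal (waitDensity r a y)) y =
      ∫⁻ y in Set.Ici 0, B.indicator (fun y => ENNReal.ofReal (waitDensity r a y)) y := by
    rw [← lintegral_indicator measurableSet_Ici]
    refine lintegral_congr fun y => ?_
    by_cases hy : y ∈ Set.Ici 0
    · rw [Set.indicator_of_mem hy]
    · have : waitDensity r a y = 0 := if_pos (not_le.1 hy).le
      simp [Set.indicator, this]
  rw [hI, setLIntegral_Ici_eq_tsum ha (hf.ennreal_ofReal.indicator hB), smul_eq_mul,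
    ← lintegral_const_mul _ hm]
  refine setLIntegral_congr_fun measurableSet_Ioo fun u hu => ?_
  rw [measure_waitFrom_of_pos hr ha hρ hu.1, ← ENNReal.tsum_mul_left]
  refine tsum_congr fun k => ?_
  by_cases hk : u + k * a ∈ B
  · rw [Set.indicator_of_mem hk, Set.indicator_of_mem hk, waitDensity_add_mul ha hu,
      ENNReal.ofReal_mul hr.le]
  · rw [Set.indicator_of_notMem hk, Set.indicator_of_notMem hk, mul_zero]

lemma sum_interarrival {Ω : Type*} (T : ℕ → Ω → ℝ) (n : ℕ) (ω : Ω) :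
    ∑ i ∈ Finset.range (n + 1), interarrival T i ω = T n ω := by
  induction n with
  | zero => simp [interarrival]
  | succ n ih =>
    rw [Finset.sum_range_succ, ih]
    simp [interarrival]

end Equilibrium

theorem mainTheorem1 {Ω : Type*} [MeasurableSpace Ω] (P : Measure Ω) [IsProbabilityMeasure P]
    (r a : ℝ) (hr : 0 < r) (ha : 0 < a) (hρ : r * a < 1)
    (T : ℕ → Ω → ℝ) (hT : IsPoissonArrivals P r T) :
    (∀ᵐ ω ∂P, ∀ n, ∃! j, (lifoService a (fun m => T m ω) j).customer = n) ∧
    ∃ f : ℝ → ℝ, Measurable f ∧ (∀ x, 0 ≤ f x) ∧ (∀ x ≤ 0, f x = 0) ∧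
      (∀ (k : ℕ) (x : ℝ), k * a < x → x < (k + 1) * a →
        f x = r ^ (k + 1) * x ^ ((k : ℤ) - 1) * (x - k * a) * Real.exp (-(r * x)) /
          (k.factorial : ℝ)) ∧
      IsEquilibriumLaw P (fun n ω => lifoWait a (fun m => T m ω) n)
        (ENNReal.ofReal (1 - r * a) • Measure.dirac 0 +
          volume.withDensity (fun x => ENNReal.ofReal (f x))) := by
  have := isProbabilityMeasure_expMeasure hr
  have hlaw : HasLaw (fun ω i => interarrival T i ω) (interarrivalLaw r) P :=
    hT.iIndepFun_interarrival.hasLaw_infinitePi hT.hasLaw_interarrival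
      (aemeasurable_pi_iff.2 fun i => (hT.hasLaw_interarrival i).aemeasurable)
  have hstable : ∀ᵐ ω ∂P, IsStable a fun i => interarrival T i ω := by
    refine ae_of_ae_map hlaw.aemeasurable ?_
    rw [hlaw.map_eq]
    exact ae_isStable hr hρ
  have hsum : ∀ ω, (fun m => T m ω) =
      fun n => ∑ i ∈ Finset.range (n + 1), interarrival T i ω := fun ω =>
    funext fun n => (sum_interarrival T n ω).symm
  refine ⟨?_, waitDensity r a, measurable_waitDensity r a, waitDensity_nonneg hr.le ha,
    fun x hx => if_pos hx, fun k x h1 h2 => waitDensity_eq ha k h1 h2, ?_⟩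
  · filter_upwards [hstable] with ω hω n
    rw [hsum]
    exact (hω.lifoWait_eq ha n).1
  have hg : Measurable fun p : ℝ × (ℕ → ℝ) => waitFrom a (residualService a p.1, p.2) :=
    (measurable_waitFrom a).comp
      (((measurable_residualService a).comp measurable_fst).prodMk measurable_snd)
  have hpair : ∀ n, Measurable fun x : ℕ → ℝ => (workload a x n, fun i => x (n + 1 + i)) :=
    fun n => (measurable_workload a n).prodMk (by fun_prop)
  -- For each fixed `n` the forward workload may be replaced in law by the backward one, which
  -- stabilizes as `n` grows.
  have hW : ∀ n, HasLaw (fun ω => lifoWait a (fun m => T m ω) n)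
      ((((interarrivalLaw r).map (backwardWorkload a n)).prod (interarrivalLaw r)).map
        fun p => waitFrom a (residualService a p.1, p.2)) P := by
    intro n
    have h1 : HasLaw ((fun p : ℝ × (ℕ → ℝ) => waitFrom a (residualService a p.1, p.2)) ∘
        fun x : ℕ → ℝ => (workload a x n, fun i => x (n + 1 + i)))
        ((((interarrivalLaw r).map (backwardWorkload a n)).prod (interarrivalLaw r)).map
        fun p => waitFrom a (residualService a p.1, p.2)) (interarrivalLaw r) :=
      ⟨(hg.comp (hpair n)).aemeasurable, by
        rw [← Measure.map_map hg (hpair n), map_workload_future]⟩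
    refine (h1.comp hlaw).congr ?_
    filter_upwards [hstable] with ω hω
    rw [hsum]
    exact (hω.lifoWait_eq ha n).2
  refine ⟨fun n => (hW n).aemeasurable, fun B hB => ?_⟩
  simp_rw [fun n => (hW n).map_eq]
  rw [← map_waitFrom_limitWorkload hr ha hρ, Measure.map_apply hg hB]
  simp_rw [fun n => Measure.map_apply (μ := ((interarrivalLaw r).map
    (backwardWorkload a n)).prod (interarrivalLaw r)) hg hB]
  exact tendsto_map_backwardWorkload_prod hr hρ (hg hB)
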